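/- Theorem 2.1. Let $E\subset\mathbb C$ be connected, and let $\Lambda^*\subset\mathbb C$ be a domain (a nonempty connected open set) with an isolated boundary point $\lambda^*\in\mathbb C$; put $\Lambda=\Lambda^*\cup\{\lambda^*\}$. Let $\lambda_0\in\Lambda^*$ and let $H:\Lambda^*\times E\to\mathbb C$ be a holomorphic motion of $E$ over $\Lambda^*$ with base point $\lambda_0$, that is: (i) $H(\lambda_0,z)=z$ for all $z\in E$; (ii) for every $\lambda\in\Lambda^*$ the map $z\mapsto H(\lambda,z)$ is injective on $E$; (iii) for every $z\in E$ the map $H^z:\lambda\mapsto H(\lambda,z)$ is holomorphic on $\Lambda^*$. Suppose that there are two distinct points $z_0,z_1\in E$ such that $H^{z_0}$ and $H^{z_1}$ extend to holomorphic functions $\Lambda\to\mathbb C$. Then $H$ extends horizontally holomorphically to $\Lambda$: there is a map $\Lambda\times E\to\mathbb C$, $(\lambda,z)\mapsto\widehat H(\lambda,z)$, which agrees with $H$ on $\Lambda^*\times E$ and for which $\lambda\mapsto\widehat H(\lambda,z)$ is holomorphic on $\Lambda$ for every $z\in E$. -/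

import Mathlib

open Set

/-- `p` is an isolated boundary point of `Ω ⊆ ℂ`: it lies on the boundary of `Ω`, and some disk
around it contains no other boundary point. (If `Ω` is open, then `p ∉ Ω`, a punctured disk
around `p` is contained in `Ω`, and `Ω ∪ {p}` is open.) -/
def IsIsolatedBoundaryPoint (Ω : Set ℂ) (p : ℂ) : Prop :=
  p ∈ frontier Ω ∧ ∃ r > 0, Metric.ball p r ∩ frontier Ω = {p}

/-- `H : Ω × E → ℂ` is a holomorphic motion in `ℂ` of the set `E`, parametrized by `Ω`, with base
point `b`. Only the values of `H` on `Ω × E` matter. -/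
structure IsHolomorphicMotion (Ω E : Set ℂ) (b : ℂ) (H : ℂ → ℂ → ℂ) : Prop where
  base_mem : b ∈ Ω
  base : ∀ z ∈ E, H b z = z
  vertically_injective : ∀ l ∈ Ω, InjOn (fun z => H l z) E
  horizontally_holomorphic : ∀ z ∈ E, DifferentiableOn ℂ (fun l => H l z) Ω

/-- The function `f : Ω → ℂ` extends to a holomorphic function on the larger open set `Ω'`. -/
def ExtendsHolomorphically (f : ℂ → ℂ) (Ω Ω' : Set ℂ) : Prop :=
  ∃ F : ℂ → ℂ, DifferentiableOn ℂ F Ω' ∧ EqOn F f Ω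

/-- `H : Ω × E → ℂ` extends horizontally holomorphically to `Ω'`: there is an extension of `H`
to `Ω' × E`, each of whose horizontal slices is holomorphic on `Ω'`. -/
def ExtendsHorizontallyHolomorphically (H : ℂ → ℂ → ℂ) (Ω Ω' E : Set ℂ) : Prop :=
  ∃ G : ℂ → ℂ → ℂ, (∀ z ∈ E, DifferentiableOn ℂ (fun l => G l z) Ω') ∧
    ∀ l ∈ Ω, ∀ z ∈ E, G l z = H l z

open Filter Topology Metric

/-! For distinct `x, y, w` in `E` the quotient `(H l y - H l w) / (H l x - H l w)` is holomorphic in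
`l` and omits 0 and 1. By Schottky's theorem, if `y` is close to `x` the quotient is close to 1 on a
fixed circle around `p`. Picard's great theorem makes it or its inverse bounded near `p`, and the
maximum principle then keeps its modulus between 1/2 and 2 inside the circle. So the growth class at
`p` of `H l x - H l w` is locally constant in `x ≠ w` (`IsHolomorphicMotion.eventually_isTheta`).
Although `E \ {w}` may be disconnected, the symmetry of this class in `x` and `w` makes it constant
there (`IsPreconnected.eq_of_symmetric_of_eventually_eq`). Hence every `H l z - H l z₀` with `z ≠
z₀` grows like `H l z₁ - H l z₀`, which is bounded, and the singularity at `p` is removable. -/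

/-! ### Holomorphic logarithms and arccosines -/

theorem exists_differentiableOn_log_ball {c : ℂ} {R : ℝ} (hR : 0 < R) {f : ℂ → ℂ}
    (hf : DifferentiableOn ℂ f (ball c R)) (h0 : ∀ z ∈ ball c R, f z ≠ 0) :
    ∃ L : ℂ → ℂ, DifferentiableOn ℂ L (ball c R) ∧ ∀ z ∈ ball c R, Complex.exp (L z) = f z := by
  have hc : c ∈ ball c R := mem_ball_self hR
  have hd : DifferentiableOn ℂ (fun z => deriv f z / f z) (ball c R) :=
    (hf.deriv isOpen_ball).div hf h0
  obtain ⟨L, hLc, hL⟩ := hd.isExactOn_ball.with_val_at c (Complex.log (f c))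
  refine ⟨L, fun z hz => (hL z hz).differentiableAt.differentiableWithinAt, fun z hz => ?_⟩
  have hq : ∀ x ∈ ball c R, HasDerivAt (fun z => f z * Complex.exp (-L z)) 0 x := by
    intro x hx
    have h1 := (hf.differentiableAt (isOpen_ball.mem_nhds hx)).hasDerivAt
    convert! h1.mul (hL x hx).neg.cexp using 1
    field_simp [h0 x hx]
    ring
  have hconst := (convex_ball c R).is_const_of_fderivWithin_eq_zero (𝕜 := ℂ)
    (f := fun z => f z * Complex.exp (-L z))
    (fun x hx => (hq x hx).differentiableAt.differentiableWithinAt)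
    (fun x hx => by
      rw [fderivWithin_of_isOpen isOpen_ball hx, (hq x hx).hasFDerivAt.fderiv]; ext; simp) hz hc
  simp only [hLc, Complex.exp_neg, Complex.exp_log (h0 c hc), mul_inv_cancel₀ (h0 c hc)] at hconst
  field_simp at hconst
  exact hconst.symm

theorem Complex.abs_im_le_norm_cos (v : ℂ) : |v.im| ≤ ‖Complex.cos v‖ := by
  have key : Real.sinh |v.im| ≤ ‖Complex.cos v‖ := by
    have h2 : ‖Complex.cos v‖ = ‖Complex.exp (v * I) + Complex.exp (-v * I)‖ / 2 := by
      rw [Complex.cos]; simp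
    have h3 := abs_norm_sub_norm_le (Complex.exp (v * I)) (-Complex.exp (-v * I))
    rw [sub_neg_eq_add, norm_neg, Complex.norm_exp, Complex.norm_exp] at h3
    simp only [mul_re, I_re, I_im, neg_re, neg_im, mul_zero, mul_one, zero_sub, neg_neg] at h3
    rw [h2, Real.sinh_eq]
    rcases le_total 0 v.im with h | h
    · rw [abs_of_nonneg h]
      have := (abs_le.mp h3).1
      linarith
    · rw [abs_of_nonpos h, neg_neg]
      have := (abs_le.mp h3).2
      linarith
  exact (Real.self_le_sinh_iff.mpr (abs_nonneg _)).trans key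

theorem Complex.norm_cos_le_exp_norm (v : ℂ) : ‖Complex.cos v‖ ≤ Real.exp ‖v‖ := by
  have h1 : ‖Complex.exp (v * I)‖ ≤ Real.exp ‖v‖ := by
    simpa using Complex.norm_exp_le_exp_norm (v * I)
  have h2 : ‖Complex.exp (-v * I)‖ ≤ Real.exp ‖v‖ := by
    simpa using Complex.norm_exp_le_exp_norm (-v * I)
  have h3 := norm_add_le (Complex.exp (v * I)) (Complex.exp (-v * I))
  rw [Complex.cos, norm_div, Complex.norm_ofNat]
  linarith

/-- With `S` a root of `1 - h ^ 2`, the function `h + i S` has inverse `h - i S`, so it has a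
logarithm, and that is `iπF`. -/
theorem exists_differentiableOn_arccos_ball {c : ℂ} {R : ℝ} (hR : 0 < R) {h : ℂ → ℂ}
    (hd : DifferentiableOn ℂ h (ball c R)) (h1 : ∀ z ∈ ball c R, h z ^ 2 ≠ 1) :
    ∃ F : ℂ → ℂ, DifferentiableOn ℂ F (ball c R) ∧
      (∀ z ∈ ball c R, Complex.cos (Real.pi * F z) = h z) ∧ ‖F c‖ ≤ 1 + ‖h c‖ := by
  obtain ⟨L, hLd, hL⟩ := exists_differentiableOn_log_ball hR (f := fun z => 1 - h z ^ 2)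
    ((differentiableOn_const 1).sub (hd.pow 2)) (fun z hz => sub_ne_zero.mpr (h1 z hz).symm)
  set S : ℂ → ℂ := fun z => Complex.exp (L z / 2) with hS
  have hS2 : ∀ z ∈ ball c R, S z ^ 2 = 1 - h z ^ 2 := fun z hz => by
    rw [hS, ← Complex.exp_nat_mul, ← hL z hz]; congr 1; push_cast; ring
  have hSd : DifferentiableOn ℂ S (ball c R) := (hLd.div_const 2).cexp
  have hprod : ∀ z ∈ ball c R, (h z + Complex.I * S z) * (h z - Complex.I * S z) = 1 := by
    intro z hz
    have := hS2 z hz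
    linear_combination (S z)^2 * (-Complex.I_sq) + this
  obtain ⟨M, hMd, hM⟩ := exists_differentiableOn_log_ball hR (f := fun z => h z + Complex.I * S z)
    (hd.add (hSd.const_mul _)) (fun z hz => left_ne_zero_of_mul_eq_one (hprod z hz))
  have hpi : (Real.pi : ℂ) ≠ 0 := by exact_mod_cast Real.pi_ne_zero
  set F₀ : ℂ → ℂ := fun z => M z / (Real.pi * Complex.I) with hF₀
  -- Shifting by the period 2 of `cos (π ·)` brings the real part at `c` into `[-1, 1]`; the
  -- imaginary part is bounded by `‖h c‖` anyway.
  set k : ℤ := round ((F₀ c).re / 2) with hk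
  have hcos : ∀ z ∈ ball c R, Complex.cos (Real.pi * (F₀ z - 2 * k)) = h z := by
    intro z hz
    have e1 : (Real.pi : ℂ) * (F₀ z - 2 * k) = Real.pi * F₀ z - k * (2 * Real.pi) := by ring
    rw [e1, Complex.cos_sub_int_mul_two_pi, Complex.cos]
    have e2 : (Real.pi : ℂ) * F₀ z * Complex.I = M z := by
      rw [hF₀]; field_simp
    rw [neg_mul, e2, Complex.exp_neg, hM z hz]
    rw [inv_eq_of_mul_eq_one_right (hprod z hz)]
    ring
  refine ⟨fun z => F₀ z - 2 * k, (hMd.div_const _).sub_const _, hcos, ?_⟩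
  have hc : c ∈ ball c R := mem_ball_self hR
  have him := Complex.abs_im_le_norm_cos (Real.pi * (F₀ c - 2 * k))
  rw [hcos c hc, Complex.im_ofReal_mul, abs_mul, abs_of_pos Real.pi_pos] at him
  have hre : |(F₀ c - 2 * k).re| ≤ 1 := by
    have h2 := abs_sub_round ((F₀ c).re / 2)
    rw [← hk] at h2
    have h3 : (F₀ c - 2 * k).re = 2 * ((F₀ c).re / 2 - k) := by
      simp; ring
    rw [h3, abs_mul, abs_two]
    linarith
  have him' : |(F₀ c - 2 * k).im| ≤ ‖h c‖ := by
    have : 1 ≤ Real.pi := by linarith [Real.pi_gt_three]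
    nlinarith [abs_nonneg (F₀ c - 2 * k).im]
  linarith [Complex.norm_le_abs_re_add_abs_im (F₀ c - 2 * k)]

/-- At `u = 2k + is` the value is `cosh (πs)`, which grows by at least 1 as `|s|` grows by 1. Such
points with integer value are thus at most 1 away from `v` in each coordinate. -/
theorem exists_near_cos_pi_mul_eq_int (v : ℂ) :
    ∃ u : ℂ, dist u v < 2 ∧ ∃ n : ℤ, Complex.cos (Real.pi * u) = n := by
  have hpi := Real.pi_gt_three
  have hcont : ContinuousOn (fun t : ℝ => Real.cosh (Real.pi * t)) (Icc |v.im| (|v.im| + 1)) := by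
    fun_prop
  have hstep : Real.cosh (Real.pi * |v.im|) + 1 ≤ Real.cosh (Real.pi * (|v.im| + 1)) := by
    rw [mul_add, mul_one, Real.cosh_add]
    have h1 := Real.one_le_cosh (Real.pi * |v.im|)
    have h2 : 0 ≤ Real.sinh (Real.pi * |v.im|) := Real.sinh_nonneg_iff.mpr (by positivity)
    have h3 : 0 ≤ Real.sinh Real.pi := Real.sinh_nonneg_iff.mpr (by positivity)
    have h4 : 2 ≤ Real.cosh Real.pi := by
      have := Real.self_le_sinh_iff.mpr Real.pi_pos.le
      have := Real.sinh_lt_cosh Real.pi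
      linarith
    nlinarith [mul_nonneg h2 h3]
  obtain ⟨t, ht, htn⟩ := intermediate_value_Icc (by linarith) hcont
    (show ((⌈Real.cosh (Real.pi * |v.im|)⌉ : ℤ) : ℝ) ∈ _ from
      ⟨Int.le_ceil _, ((Int.ceil_lt_add_one _).le).trans hstep⟩)
  obtain ⟨s, hs, hsn⟩ : ∃ s : ℝ, |s - v.im| ≤ 1 ∧ Real.cosh (Real.pi * s) =
      (⌈Real.cosh (Real.pi * |v.im|)⌉ : ℤ) := by
    rcases le_total 0 v.im with h | h
    · rw [abs_of_nonneg h] at ht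
      exact ⟨t, abs_le.mpr ⟨by linarith [ht.1], by linarith [ht.2]⟩, htn⟩
    · rw [abs_of_nonpos h] at ht
      exact ⟨-t, abs_le.mpr ⟨by linarith [ht.2], by linarith [ht.1]⟩, by
        rw [mul_neg, Real.cosh_neg]; exact htn⟩
  set k : ℤ := round (v.re / 2) with hk
  refine ⟨2 * k + s * Complex.I, ?_, ⌈Real.cosh (Real.pi * |v.im|)⌉, ?_⟩
  · have hre : |2 * (k : ℝ) - v.re| ≤ 1 := by
      have h2 := abs_sub_round (v.re / 2)
      rw [← hk] at h2
      rw [abs_le] at h2 ⊢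
      constructor <;> linarith [h2.1, h2.2]
    rw [Complex.dist_eq_re_im, Real.sqrt_lt' two_pos]
    simp only [Complex.add_re, Complex.add_im, Complex.mul_re, Complex.mul_im, Complex.re_ofNat,
      Complex.im_ofNat, Complex.intCast_re, Complex.intCast_im, Complex.ofReal_re,
      Complex.ofReal_im, Complex.I_re, Complex.I_im, mul_zero, zero_mul, mul_one, sub_zero,
      add_zero, zero_add]
    nlinarith [sq_le_one_iff_abs_le_one (2 * (k : ℝ) - v.re) |>.mpr hre,
      sq_le_one_iff_abs_le_one (s - v.im) |>.mpr hs]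
  · have e : (Real.pi : ℂ) * (2 * k + s * Complex.I) =
        (Real.pi * s : ℝ) * Complex.I + k * (2 * Real.pi) := by push_cast; ring
    rw [e, Complex.cos_add_int_mul_two_pi, Complex.cos_mul_I, ← Complex.ofReal_cosh, hsn]
    simp

/-! ### A Bloch-type theorem -/

theorem ball_subset_image_of_norm_deriv_le_two_mul {g : ℂ → ℂ} {a : ℂ} {t : ℝ} (ht : 0 < t)
    (hg : DifferentiableOn ℂ g (ball a t)) (ha : deriv g a ≠ 0)
    (hb : ∀ z ∈ ball a t, ‖deriv g z‖ ≤ 2 * ‖deriv g a‖) :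
    ball (g a) (‖deriv g a‖ * t / 24) ⊆ g '' ball a t := by
  have hm : 0 < ‖deriv g a‖ := norm_pos_iff.mpr ha
  have hsub : closedBall a (t / 6) ⊆ ball a t := closedBall_subset_ball (by linarith)
  -- Schwarz's lemma for `deriv g`; on radius `t / 6` the linear part of `g` then dominates.
  have hder : ∀ z ∈ closedBall a (t / 6), ‖deriv g z - deriv g a‖ ≤ ‖deriv g a‖ / 2 := by
    intro z hz
    have hmaps : MapsTo (deriv g) (ball a t) (closedBall (deriv g a) (3 * ‖deriv g a‖)) := by
      intro x hx
      rw [mem_closedBall, dist_eq_norm]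
      linarith [norm_sub_le (deriv g x) (deriv g a), hb x hx]
    have h1 := Complex.dist_le_div_mul_dist_of_mapsTo_ball (hg.deriv isOpen_ball) hmaps (hsub hz)
    rw [dist_eq_norm] at h1
    rw [mem_closedBall] at hz
    calc ‖deriv g z - deriv g a‖ ≤ 3 * ‖deriv g a‖ / t * dist z a := h1
      _ ≤ 3 * ‖deriv g a‖ / t * (t / 6) := by gcongr
      _ = ‖deriv g a‖ / 2 := by field_simp; norm_num
  have hlin : ∀ z ∈ closedBall a (t / 6),
      ‖g z - g a - deriv g a * (z - a)‖ ≤ ‖deriv g a‖ / 2 * ‖z - a‖ := by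
    intro z hz
    have hh : ∀ x ∈ closedBall a (t / 6), HasDerivWithinAt (fun x => g x - deriv g a * x)
        (deriv g x - deriv g a) (closedBall a (t / 6)) x := by
      intro x hx
      have h1 := (hg.differentiableAt (isOpen_ball.mem_nhds (hsub hx))).hasDerivAt
      convert! (h1.sub ((hasDerivAt_id x).const_mul (deriv g a))).hasDerivWithinAt using 1
      simp
    have h2 := (convex_closedBall a (t / 6)).norm_image_sub_le_of_norm_hasDerivWithin_le hh hder
      (mem_closedBall_self (by positivity)) hz
    rw [show g z - g a - deriv g a * (z - a) = g z - deriv g a * z - (g a - deriv g a * a) by ring]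
    exact h2
  have hsph : ∀ z ∈ sphere a (t / 6), ‖deriv g a‖ * t / 12 ≤ ‖g z - g a‖ := by
    intro z hz
    have h1 := hlin z (sphere_subset_closedBall hz)
    have h2 : ‖z - a‖ = t / 6 := by simpa [dist_eq_norm] using hz
    have h3 := norm_sub_norm_le (deriv g a * (z - a)) (deriv g a * (z - a) - (g z - g a))
    rw [norm_sub_rev (deriv g a * (z - a)) (g z - g a), norm_mul, h2, sub_sub_cancel] at h3
    rw [h2] at h1
    linarith
  have hfreq : ∃ᶠ z in 𝓝 a, g z ≠ g a := by
    intro h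
    have : g =ᶠ[𝓝 a] fun _ => g a := by
      filter_upwards [h] with z hz using not_not.mp hz
    exact ha (by rw [this.deriv_eq]; simp)
  have h := (hg.diffContOnCl_ball hsub).ball_subset_image_closedBall (by positivity) hsph hfreq
  refine Subset.trans (ball_subset_ball ?_) (h.trans (image_mono hsub))
  linarith

/-- At a maximum `a` of `‖deriv g z‖ * (r - dist z c)` the derivative at most doubles on the disk of
half the remaining radius, so the previous lemma applies there. -/
theorem norm_deriv_mul_le_of_not_ball_subset_image {g : ℂ → ℂ} {c : ℂ} {R : ℝ} (hR : 0 < R)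
    (hg : DifferentiableOn ℂ g (ball c R)) (hball : ∀ v, ¬ ball v 2 ⊆ g '' ball c R) :
    ‖deriv g c‖ * R ≤ 192 := by
  by_contra! hcon
  set r := R / 2 with hr
  have hr0 : 0 < r := by positivity
  have hsub : closedBall c r ⊆ ball c R := closedBall_subset_ball (by linarith)
  have hcont : ContinuousOn (fun z => ‖deriv g z‖ * (r - dist z c)) (closedBall c r) :=
    ((hg.deriv isOpen_ball).continuousOn.mono hsub).norm.mul (by fun_prop)
  obtain ⟨a, ha, hmax⟩ := (isCompact_closedBall c r).exists_isMaxOn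
    ⟨c, mem_closedBall_self hr0.le⟩ hcont
  have hmaxc := hmax (mem_closedBall_self hr0.le)
  simp only [mem_ofPred_eq, dist_self, sub_zero] at hmaxc
  have hpos : 96 < ‖deriv g a‖ * (r - dist a c) := by
    have : ‖deriv g c‖ * R = 2 * (‖deriv g c‖ * r) := by rw [hr]; ring
    linarith
  have hrd : 0 ≤ r - dist a c := sub_nonneg.mpr ha
  have hrd' : 0 < r - dist a c := by
    rcases hrd.eq_or_lt with h | h
    · rw [← h] at hpos; norm_num at hpos
    · exact h
  have hda : deriv g a ≠ 0 := by
    rintro h; rw [h] at hpos; norm_num at hpos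
  set t := (r - dist a c) / 2 with ht
  have ht0 : 0 < t := by positivity
  have hballsub : ball a t ⊆ closedBall c r := by
    intro z hz
    rw [mem_ball] at hz
    rw [mem_closedBall]
    linarith [dist_triangle z a c]
  have h := ball_subset_image_of_norm_deriv_le_two_mul ht0 (hg.mono (hballsub.trans hsub)) hda
    (fun z hz => by
      have h1 := hmax (hballsub hz)
      simp only [mem_ofPred_eq] at h1
      rw [mem_ball] at hz
      have h2 : t ≤ r - dist z c := by linarith [dist_triangle z a c]
      have h3 : ‖deriv g z‖ * t ≤ (2 * ‖deriv g a‖) * t := by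
        calc ‖deriv g z‖ * t ≤ ‖deriv g z‖ * (r - dist z c) := by gcongr
          _ ≤ ‖deriv g a‖ * (r - dist a c) := h1
          _ = (2 * ‖deriv g a‖) * t := by rw [ht]; ring
      exact le_of_mul_le_mul_right h3 ht0)
  refine hball (g a) ((ball_subset_ball ?_).trans (h.trans (image_mono (hballsub.trans hsub))))
  rw [ht]
  linarith

/-! ### Schottky's theorem and its form for small values -/

/-- Schottky's theorem. -/
theorem exists_forall_norm_le_of_omits_zero_one (M : ℝ) :
    ∃ C : ℝ, ∀ (f : ℂ → ℂ) (c : ℂ) (R : ℝ), 0 < R → DifferentiableOn ℂ f (ball c R) →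
      (∀ z ∈ ball c R, f z ≠ 0) → (∀ z ∈ ball c R, f z ≠ 1) → ‖f c‖ ≤ M →
      ∀ z ∈ closedBall c (R / 2), ‖f z‖ ≤ C := by
  -- Write `2f - 1 = cos πF` and `F = cos πg`. Then `‖g c‖ ≤ 2M + 3`, `g` moves by at most 192, and
  -- each cosine costs one exponential.
  refine ⟨1 + Real.exp (Real.pi * Real.exp (Real.pi * (2 * M + 195))), ?_⟩
  intro f c R hR hf h0 h1 hM z hz
  have hc : c ∈ ball c R := mem_ball_self hR
  obtain ⟨F, hFd, hF, hFc⟩ := exists_differentiableOn_arccos_ball hR (h := fun z => 2 * f z - 1)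
    ((hf.const_mul 2).sub_const 1) (fun z hz h => by
      have : f z * (f z - 1) = 0 := by linear_combination h / 4
      rcases mul_eq_zero.mp this with h | h
      · exact h0 z hz h
      · exact h1 z hz (sub_eq_zero.mp h))
  have hFint : ∀ z ∈ ball c R, ∀ n : ℤ, F z ≠ n := by
    intro z hz n hn
    have h2 := hF z hz
    have h3 : Complex.sin (Real.pi * F z) = 0 := by
      rw [hn, mul_comm]; exact Complex.sin_int_mul_pi n
    have h4 := Complex.sin_sq_add_cos_sq (Real.pi * F z)
    rw [h3, h2] at h4
    have : f z * (f z - 1) = 0 := by linear_combination h4 / 4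
    rcases mul_eq_zero.mp this with h | h
    · exact h0 z hz h
    · exact h1 z hz (sub_eq_zero.mp h)
  obtain ⟨g, hgd, hg, hgc⟩ := exists_differentiableOn_arccos_ball hR hFd (fun z hz h => by
      rcases sq_eq_sq_iff_eq_or_eq_neg.mp (h.trans (one_pow 2).symm) with h | h
      · exact hFint z hz 1 (by simpa using h)
      · exact hFint z hz (-1) (by simpa using h))
  -- `F` omits the integers, so `g` omits every `u` with `cos πu` an integer, and these meet every
  -- disk of radius 2.
  have hgball : ∀ v, ¬ ball v 2 ⊆ g '' ball c R := by
    intro v hv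
    obtain ⟨u, hu, n, hn⟩ := exists_near_cos_pi_mul_eq_int v
    obtain ⟨w, hw, rfl⟩ := hv hu
    exact hFint w hw n (by rw [← hg w hw, hn])
  have hderiv : ∀ w ∈ closedBall c (R / 2), ‖deriv g w‖ ≤ 384 / R := by
    intro w hw
    have hs : ball w (R / 2) ⊆ ball c R := ball_subset_ball' (by
      rw [mem_closedBall] at hw; linarith)
    have := norm_deriv_mul_le_of_not_ball_subset_image (half_pos hR) (hgd.mono hs)
      (fun v hv => hgball v (hv.trans (image_mono hs)))
    rw [le_div_iff₀ hR]
    linarith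
  have hgz : ‖g z - g c‖ ≤ 192 := by
    have := (convex_closedBall c (R / 2)).norm_image_sub_le_of_norm_deriv_le
      (fun x hx => hgd.differentiableAt (isOpen_ball.mem_nhds
        (closedBall_subset_ball (half_lt_self hR) hx))) hderiv
      (mem_closedBall_self (by positivity)) hz
    rw [mem_closedBall, dist_eq_norm] at hz
    calc ‖g z - g c‖ ≤ 384 / R * ‖z - c‖ := this
      _ ≤ 384 / R * (R / 2) := by gcongr
      _ = 192 := by field_simp; norm_num
  have hzR : z ∈ ball c R := closedBall_subset_ball (half_lt_self hR) hz
  have hhc : ‖2 * f c - 1‖ ≤ 2 * M + 1 := by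
    have := norm_sub_le (2 * f c) 1
    rw [norm_mul, Complex.norm_ofNat, norm_one] at this
    linarith
  have hgz' : ‖g z‖ ≤ 2 * M + 195 := by
    have := norm_le_norm_add_norm_sub' (g z) (g c)
    linarith
  have hFz : ‖F z‖ ≤ Real.exp (Real.pi * (2 * M + 195)) := by
    rw [← hg z hzR]
    refine (Complex.norm_cos_le_exp_norm _).trans (Real.exp_le_exp.mpr ?_)
    rw [norm_mul, Complex.norm_real, Real.norm_of_nonneg Real.pi_pos.le]
    gcongr
  have hhz : ‖2 * f z - 1‖ ≤ Real.exp (Real.pi * Real.exp (Real.pi * (2 * M + 195))) := by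
    rw [← hF z hzR]
    refine (Complex.norm_cos_le_exp_norm _).trans (Real.exp_le_exp.mpr ?_)
    rw [norm_mul, Complex.norm_real, Real.norm_of_nonneg Real.pi_pos.le]
    gcongr
  have h5 := norm_add_le (2 * f z - 1) 1
  rw [sub_add_cancel, norm_mul, Complex.norm_ofNat, norm_one] at h5
  linarith [norm_nonneg (f z)]

/-- Schottky's theorem for `1 / f`, centred at `z` instead of `c`: if `f z` is not small, neither is
`f c`. -/
theorem exists_forall_norm_lt_of_omits_zero_one {δ : ℝ} (hδ : 0 < δ) :
    ∃ ε > 0, ∀ (f : ℂ → ℂ) (c : ℂ) (R : ℝ), 0 < R → DifferentiableOn ℂ f (ball c R) →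
      (∀ z ∈ ball c R, f z ≠ 0) → (∀ z ∈ ball c R, f z ≠ 1) → ‖f c‖ < ε →
      ∀ z ∈ ball c (R / 4), ‖f z‖ < δ := by
  obtain ⟨C, hC⟩ := exists_forall_norm_le_of_omits_zero_one δ⁻¹
  refine ⟨(max C 1)⁻¹, by positivity, fun f c R hR hf h0 h1 hfc z hz => ?_⟩
  by_contra! hcon
  rw [mem_ball] at hz
  have hs : ball z (R / 2) ⊆ ball c R := ball_subset_ball' (by linarith)
  have h := hC (fun x => (f x)⁻¹) z (R / 2) (half_pos hR) ((hf.mono hs).inv fun x hx => h0 x (hs hx))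
    (fun x hx => inv_ne_zero (h0 x (hs hx))) (fun x hx => by simpa using h1 x (hs hx))
    (by rw [norm_inv]; exact inv_anti₀ hδ hcon) c
    (by rw [mem_closedBall, dist_comm]; linarith)
  rw [norm_inv] at h
  have h2 : 0 < ‖f c‖ := norm_pos_iff.mpr (h0 c (mem_ball_self hR))
  have h3 : max C 1 < ‖f c‖⁻¹ := (lt_inv_comm₀ (by positivity) h2).mpr hfc
  exact absurd (h3.trans_le h) (not_lt.mpr (le_max_left C 1))

/-! ### Isolated singularities of functions omitting 0 and 1 -/

/-- The map `u ↦ p + exp u` lifts `f` to a half-plane. The factor `exp (-2π)` leaves room for a disk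
of radius at least `2π` around `log (z - p)`, whose concentric half covers the whole circle through
`z`. -/
theorem exists_forall_circle_norm_le_of_omits_zero_one :
    ∃ C : ℝ, ∀ (f : ℂ → ℂ) (p : ℂ) (R : ℝ), 0 < R → DifferentiableOn ℂ f (ball p R \ {p}) →
      (∀ z ∈ ball p R \ {p}, f z ≠ 0) → (∀ z ∈ ball p R \ {p}, f z ≠ 1) →
      ∀ z, z ≠ p → dist z p ≤ R * Real.exp (-(2 * Real.pi)) → ‖f z‖ ≤ 1 →
      ∀ w, dist w p = dist z p → ‖f w‖ ≤ C := by
  obtain ⟨C, hC⟩ := exists_forall_norm_le_of_omits_zero_one 1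
  refine ⟨C, fun f p R hR hf h0 h1 z hzp hz hfz w hw => ?_⟩
  have hzp' : z - p ≠ 0 := sub_ne_zero.mpr hzp
  have hd : 0 < dist z p := dist_pos.mpr hzp
  set u₀ := Complex.log (z - p) with hu₀
  have hre : u₀.re = Real.log (dist z p) := by rw [hu₀, Complex.log_re, dist_eq_norm]
  have hrad : 2 * Real.pi ≤ Real.log R - u₀.re := by
    have := Real.log_le_log hd hz
    rw [Real.log_mul hR.ne' (Real.exp_pos _).ne', Real.log_exp] at this
    rw [hre]
    linarith
  have hmaps : MapsTo (fun u => p + Complex.exp u) (ball u₀ (Real.log R - u₀.re))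
      (ball p R \ {p}) := by
    intro u hu
    refine ⟨?_, by simp⟩
    rw [mem_ball, dist_eq_norm] at hu ⊢
    rw [add_sub_cancel_left, Complex.norm_exp, ← Real.lt_log_iff_exp_lt hR]
    have := (Complex.re_le_norm (u - u₀)).trans_lt hu
    rw [Complex.sub_re] at this
    linarith
  set θ := Complex.arg ((w - p) / (z - p)) with hθ
  have hpi := Real.pi_pos
  have h := hC (fun u => f (p + Complex.exp u)) u₀ (Real.log R - u₀.re) (by linarith)
    (hf.comp ((differentiable_const p).add Complex.differentiable_exp).differentiableOn hmaps)
    (fun u hu => h0 _ (hmaps hu)) (fun u hu => h1 _ (hmaps hu))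
    (by rwa [hu₀, Complex.exp_log hzp', add_sub_cancel]) (u₀ + θ * Complex.I) (by
      rw [mem_closedBall, dist_eq_norm, add_sub_cancel_left, norm_mul, Complex.norm_I, mul_one,
        Complex.norm_real, Real.norm_eq_abs]
      linarith [Complex.abs_arg_le_pi ((w - p) / (z - p))])
  have hn : ‖(w - p) / (z - p)‖ = 1 := by
    rw [norm_div, ← dist_eq_norm, ← dist_eq_norm, hw, div_self hd.ne']
  have he : Complex.exp (θ * Complex.I) = (w - p) / (z - p) := by
    have := Complex.norm_mul_exp_arg_mul_I ((w - p) / (z - p))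
    rwa [hn, Complex.ofReal_one, one_mul] at this
  rwa [Complex.exp_add, he, hu₀, Complex.exp_log hzp', mul_div_cancel₀ _ hzp',
    add_sub_cancel] at h

/-- Picard's great theorem. -/
theorem eventually_norm_le_or_eventually_one_lt_norm {f : ℂ → ℂ} {p : ℂ} {R : ℝ} (hR : 0 < R)
    (hf : DifferentiableOn ℂ f (ball p R \ {p})) (h0 : ∀ z ∈ ball p R \ {p}, f z ≠ 0)
    (h1 : ∀ z ∈ ball p R \ {p}, f z ≠ 1) :
    (∃ C : ℝ, ∀ᶠ z in 𝓝[≠] p, ‖f z‖ ≤ C) ∨ ∀ᶠ z in 𝓝[≠] p, 1 < ‖f z‖ := by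
  obtain ⟨C, hC⟩ := exists_forall_circle_norm_le_of_omits_zero_one
  rw [or_iff_not_imp_right]
  intro hfreq
  have hfreq' : ∀ ε > 0, ∃ z, z ≠ p ∧ dist z p < ε ∧ ‖f z‖ ≤ 1 := by
    intro ε hε
    rw [not_eventually] at hfreq
    obtain ⟨z, hz, hzε, hzp⟩ := (hfreq.and_eventually
      (inter_mem (mem_nhdsWithin_of_mem_nhds (ball_mem_nhds p hε)) self_mem_nhdsWithin)).exists
    exact ⟨z, hzp, hzε, not_lt.mp hz⟩
  have hcirc := hC f p R hR hf h0 h1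
  set ρ := R * Real.exp (-(2 * Real.pi)) with hρ
  have hρ0 : 0 < ρ := by positivity
  have hρR : ρ < R := mul_lt_of_lt_one_right hR (by
    rw [Real.exp_lt_one_iff]; linarith [Real.pi_pos])
  obtain ⟨z₁, hz₁p, hz₁, hfz₁⟩ := hfreq' ρ hρ0
  refine ⟨C, ?_⟩
  filter_upwards [mem_nhdsWithin_of_mem_nhds (ball_mem_nhds p (dist_pos.mpr hz₁p)),
    self_mem_nhdsWithin] with z hz hzp
  obtain ⟨z₂, hz₂p, hz₂, hfz₂⟩ := hfreq' (dist z p) (dist_pos.mpr hzp)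
  have hz₂d := dist_pos.mpr hz₂p
  rw [mem_ball] at hz
  -- Both boundary circles of this annulus pass through points where `‖f‖ ≤ 1`, so `‖f‖ ≤ C` on them
  -- and the maximum principle applies.
  set U : Set ℂ := ball p (dist z₁ p) ∩ (closedBall p (dist z₂ p))ᶜ with hU
  have hclos : closure U ⊆ closedBall p (dist z₁ p) ∩ (ball p (dist z₂ p))ᶜ :=
    closure_minimal (inter_subset_inter ball_subset_closedBall
      (compl_subset_compl.mpr ball_subset_closedBall)) (isClosed_closedBall.inter
      isOpen_ball.isClosed_compl)
  have hclosR : closure U ⊆ ball p R \ {p} := by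
    intro x hx
    obtain ⟨hx1, hx2⟩ := hclos hx
    rw [mem_closedBall] at hx1
    refine ⟨mem_ball.mpr (by linarith), ?_⟩
    rintro rfl
    exact hx2 (mem_ball_self hz₂d)
  have hUo : IsOpen U := isOpen_ball.inter isClosed_closedBall.isOpen_compl
  refine Complex.norm_le_of_forall_mem_frontier_norm_le (U := U)
    (isBounded_ball.subset inter_subset_left)
    ⟨hf.mono (subset_closure.trans hclosR), hf.continuousOn.mono hclosR⟩ ?_
    (subset_closure ⟨hz, fun h => absurd hz₂ (not_lt.mpr h)⟩)
  intro x hx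
  rw [hUo.frontier_eq] at hx
  obtain ⟨hx1, hx2⟩ := hclos hx.1
  rw [mem_closedBall] at hx1
  rw [mem_compl_iff, mem_ball, not_lt] at hx2
  rcases hx1.eq_or_lt with h | h
  · exact hcirc z₁ hz₁p hz₁.le hfz₁ x h
  · rcases hx2.eq_or_lt with h' | h'
    · exact hcirc z₂ hz₂p (by linarith) hfz₂ x h'.symm
    · exact absurd ⟨mem_ball.mpr h, fun hh => absurd h' (not_lt.mpr hh)⟩ hx.2

theorem norm_le_of_forall_mem_sphere_of_eventually_norm_le {f : ℂ → ℂ} {p : ℂ} {r R C c : ℝ}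
    (hr : 0 < r) (hrR : r < R) (hf : DifferentiableOn ℂ f (ball p R \ {p}))
    (hC : ∀ᶠ z in 𝓝[≠] p, ‖f z‖ ≤ C) (hc : ∀ z ∈ sphere p r, ‖f z‖ ≤ c) :
    ∀ z ∈ closedBall p r \ {p}, ‖f z‖ ≤ c := by
  rintro z ⟨hz, hzp⟩
  have hb : IsBoundedUnder (· ≤ ·) (𝓝[≠] p) fun z => ‖f z - f p‖ := by
    refine ⟨C + ‖f p‖, eventually_map.mpr ?_⟩
    filter_upwards [hC] with z hz
    linarith [norm_sub_le (f z) (f p)]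
  have hd := Complex.differentiableOn_update_limUnder_of_isLittleO
    (ball_mem_nhds p (hr.trans hrR)) hf hb.isLittleO_sub_self_inv
  have h := Complex.norm_le_of_forall_mem_frontier_norm_le (U := ball p r) isBounded_ball
    (hd.diffContOnCl_ball (closedBall_subset_ball hrR)) (C := c) (by
      intro x hx
      rw [frontier_ball p hr.ne'] at hx
      have hxp : x ≠ p := ne_of_mem_sphere hx hr.ne'
      rw [Function.update_of_ne hxp]
      exact hc x hx) (z := z) (by rwa [closure_ball p hr.ne'])
  rwa [Function.update_of_ne hzp] at h

theorem norm_bounds_of_norm_sub_one_le_on_sphere {q : ℂ → ℂ} {p : ℂ} {r R : ℝ}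
    (hr : 0 < r) (hrR : r < R) (hq : DifferentiableOn ℂ q (ball p R \ {p}))
    (h0 : ∀ z ∈ ball p R \ {p}, q z ≠ 0) (h1 : ∀ z ∈ ball p R \ {p}, q z ≠ 1)
    (hs : ∀ z ∈ sphere p r, ‖q z - 1‖ ≤ 1 / 3) :
    ∀ z ∈ closedBall p r \ {p}, 1 / 2 ≤ ‖q z‖ ∧ ‖q z‖ ≤ 2 := by
  intro z hz
  have hzR : z ∈ ball p R \ {p} := ⟨closedBall_subset_ball hrR hz.1, hz.2⟩
  rcases eventually_norm_le_or_eventually_one_lt_norm (hr.trans hrR) hq h0 h1 with ⟨C, hC⟩ | hC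
  · have h := norm_le_of_forall_mem_sphere_of_eventually_norm_le hr hrR (hq.sub_const 1)
      (C := C + 1) (by
        filter_upwards [hC] with x hx
        have := norm_sub_le (q x) 1
        rw [norm_one] at this
        linarith) hs z hz
    have h2 := abs_le.mp ((abs_norm_sub_norm_le (q z) 1).trans h)
    rw [norm_one] at h2
    constructor <;> linarith [h2.1, h2.2]
  · have hsR : sphere p r ⊆ ball p R \ {p} := fun x hx =>
      ⟨closedBall_subset_ball hrR (sphere_subset_closedBall hx), ne_of_mem_sphere hx hr.ne'⟩
    -- Now `1 / q` is the bounded one, and `‖1 / q - 1‖ ≤ (1/3) / (2/3)` on the circle.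
    have h := norm_le_of_forall_mem_sphere_of_eventually_norm_le hr hrR
      ((hq.inv h0).sub_const 1) (C := 2) (c := 1 / 2) (by
        filter_upwards [hC] with x hx
        have := norm_sub_le (q x)⁻¹ 1
        rw [norm_one, norm_inv] at this
        have := inv_le_one_of_one_le₀ hx.le
        simp only [Pi.inv_apply]
        linarith) (by
        intro x hx
        have hx0 := h0 x (hsR hx)
        have e : (q x)⁻¹ - 1 = (1 - q x) / q x := by field_simp
        have h2 := abs_le.mp ((abs_norm_sub_norm_le (q x) 1).trans (hs x hx))
        rw [norm_one] at h2
        simp only [Pi.inv_apply]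
        rw [e, norm_div, norm_sub_rev, div_le_iff₀ (norm_pos_iff.mpr hx0)]
        linarith [h2.1, hs x hx]) z hz
    simp only [Pi.inv_apply] at h
    have h2 := abs_le.mp ((abs_norm_sub_norm_le (q z)⁻¹ 1).trans h)
    rw [norm_one, norm_inv] at h2
    have hpos : 0 < ‖q z‖ := norm_pos_iff.mpr (h0 z hzR)
    have h3 : ‖q z‖⁻¹ * ‖q z‖ = 1 := inv_mul_cancel₀ hpos.ne'
    constructor <;> nlinarith [h2.1, h2.2]

/-! ### Locally constant functions on connected sets -/

theorem IsPreconnected.eq_of_eventually_eq {X Q : Type*} [TopologicalSpace X] {E : Set X}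
    (hE : IsPreconnected E) {φ : X → Q} (h : ∀ x ∈ E, ∀ᶠ y in 𝓝[E] x, φ y = φ x) {x y : X}
    (hx : x ∈ E) (hy : y ∈ E) : φ x = φ y :=
  hE.induction₂ (fun x y => φ x = φ y) (fun x hx => (h x hx).mono fun _ hy => hy.symm)
    (fun _ _ _ _ _ _ h₁ h₂ => h₁.trans h₂) (fun _ _ _ _ h => h.symm) hx hy

/-- If `S` is relatively clopen in `E \ {w}`, where `E` is connected, then `S ∪ {w}` is connected:
a function that is locally constant on `E` away from a point outside `S ∪ {w}` takes the same value
throughout `S ∪ {w}`. -/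
theorem IsPreconnected.eq_of_eventually_mem_of_eventually_eq {X Q : Type*} [TopologicalSpace X]
    {E : Set X} (hE : IsPreconnected E) {φ : X → Q} {a b w : X} {S : Set X}
    (h : ∀ x ∈ E, x ≠ a → ∀ᶠ y in 𝓝[E] x, φ y = φ x) (hw : w ∈ E) (hwa : w ≠ a)
    (hwS : w ∉ S) (haS : a ∉ S) (hS : ∀ x ∈ E, x ∈ S → ∀ᶠ y in 𝓝[E] x, y ∈ S)
    (hSc : ∀ x ∈ E, x ≠ w → x ∉ S → ∀ᶠ y in 𝓝[E] x, y ∉ S) (hbE : b ∈ E) (hb : b ∈ S) :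
    φ b = φ w := by
  classical
  -- Collapsing the rest of `E` to `w` gives a function locally constant on all of `E`, even at `a`.
  have key := hE.eq_of_eventually_eq (φ := fun x => φ (if x ∈ S then x else w)) (fun x hx => by
    by_cases hxS : x ∈ S
    · filter_upwards [hS x hx hxS, h x hx (ne_of_mem_of_not_mem hxS haS)] with y hy hyx
      simpa [hy, hxS] using hyx
    · by_cases hxw : x = w
      · subst hxw
        filter_upwards [h x hx hwa] with y hy
        by_cases hyS : y ∈ S <;> simp [hyS, hwS, hy]
      · filter_upwards [hSc x hx hxw hxS] with y hy
        simp [hy, hxS]) hbE hw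
  simpa [hb, hwS] using key

/-- A symmetric function of pairs of distinct points of a connected set that is separately locally
constant is constant in each variable. -/
theorem IsPreconnected.eq_of_symmetric_of_eventually_eq {X Q : Type*} [TopologicalSpace X]
    [T1Space X] {E : Set X} (hE : IsPreconnected E) {D : X → X → Q} (hsymm : ∀ x y, D x y = D y x)
    (hloc : ∀ w ∈ E, ∀ x ∈ E, x ≠ w → ∀ᶠ y in 𝓝[E] x, D w y = D w x) {w a b : X} (hw : w ∈ E)
    (ha : a ∈ E) (hb : b ∈ E) (haw : a ≠ w) (hbw : b ≠ w) : D w a = D w b := by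
  by_contra hne
  have hnhds : ∀ x ∈ E, x ≠ w → ∀ᶠ y in 𝓝[E] x, y ≠ w ∧ D w y = D w x := fun x hx hxw =>
    (eventually_nhdsWithin_of_eventually_nhds (isOpen_ne.eventually_mem hxw)).and
      (hloc w hw x hx hxw)
  -- The level set of `a` under `D w` and its complement in `E \ {w}` separate `a` from `b`. Working
  -- from `a` and from `b` in turn gives `D w a = D a b = D b a = D w b`.
  have h1 : D a b = D a w := hE.eq_of_eventually_mem_of_eventually_eq
    (S := {x | x ≠ w ∧ D w x ≠ D w a}) (hloc a ha) hw haw.symm (fun h => h.1 rfl) (fun h => h.2 rfl)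
    (fun x hx hxS => by
      filter_upwards [hnhds x hx hxS.1] with y hy using ⟨hy.1, hy.2 ▸ hxS.2⟩)
    (fun x hx hxw hxS => by
      filter_upwards [hnhds x hx hxw] with y hy hyS using hxS ⟨hxw, hy.2 ▸ hyS.2⟩)
    hb ⟨hbw, Ne.symm hne⟩
  have h2 : D b a = D b w := hE.eq_of_eventually_mem_of_eventually_eq
    (S := {x | x ≠ w ∧ D w x = D w a}) (hloc b hb) hw hbw.symm (fun h => h.1 rfl)
    (fun h => hne h.2.symm)
    (fun x hx hxS => by
      filter_upwards [hnhds x hx hxS.1] with y hy using ⟨hy.1, hy.2.trans hxS.2⟩)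
    (fun x hx hxw hxS => by
      filter_upwards [hnhds x hx hxw] with y hy hyS using hxS ⟨hxw, hy.2 ▸ hyS.2⟩)
    ha ⟨haw, rfl⟩
  exact hne (by rw [hsymm w a, ← h1, hsymm a b, h2, hsymm])

/-! ### The punctured disk at an isolated boundary point -/

theorem IsIsolatedBoundaryPoint.exists_punctured_ball_subset {Ω : Set ℂ} {p : ℂ}
    (hp : IsIsolatedBoundaryPoint Ω p) (hΩ : IsOpen Ω) :
    p ∉ Ω ∧ ∃ R > 0, ball p R \ {p} ⊆ Ω := by
  obtain ⟨hpf, R, hR, hpR⟩ := hp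
  have hpΩ : p ∉ Ω := by
    rw [hΩ.frontier_eq] at hpf
    exact hpf.2
  refine ⟨hpΩ, R, hR, ?_⟩
  have hconn : IsPreconnected (ball p R \ {p}) := by
    have himg : ball p R \ {p} = (fun u => p + Complex.exp u) '' {u : ℂ | u.re < Real.log R} := by
      ext z
      constructor
      · rintro ⟨hz, hzp⟩
        have hzp' : z - p ≠ 0 := sub_ne_zero.mpr hzp
        refine ⟨Complex.log (z - p), ?_, by simp [Complex.exp_log hzp']⟩
        rw [mem_ball, dist_eq_norm] at hz
        simpa [Complex.log_re] using Real.log_lt_log (norm_pos_iff.mpr hzp') hz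
      · rintro ⟨u, hu, rfl⟩
        refine ⟨?_, by simp⟩
        rw [mem_ball, dist_eq_norm, add_sub_cancel_left, Complex.norm_exp,
          ← Real.lt_log_iff_exp_lt hR]
        exact hu
    rw [himg]
    exact (convex_halfSpace_re_lt _).isPreconnected.image _ (by fun_prop)
  have hdisj : ball p R \ {p} ⊆ Ω ∪ (closure Ω)ᶜ := by
    rintro z ⟨hz, hzp⟩
    by_cases hzc : z ∈ closure Ω
    · by_contra hcon
      have hzf : z ∈ frontier Ω := by
        rw [hΩ.frontier_eq]
        exact ⟨hzc, fun h => hcon (Or.inl h)⟩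
      exact hzp (hpR ▸ ⟨hz, hzf⟩ : z ∈ ({p} : Set ℂ))
    · exact Or.inr hzc
  obtain ⟨z, hz, hzΩ⟩ := mem_closure_iff.mp (frontier_subset_closure hpf) _ isOpen_ball
    (mem_ball_self hR)
  exact hconn.subset_left_of_subset_union hΩ isClosed_closure.isOpen_compl
    (disjoint_compl_right.mono_left subset_closure) hdisj
    ⟨z, ⟨hz, ne_of_mem_of_not_mem hzΩ hpΩ⟩, hzΩ⟩

/-! ### Growth of differences of a motion near the puncture -/

namespace IsHolomorphicMotion

variable {Ω E : Set ℂ} {b : ℂ} {H : ℂ → ℂ → ℂ}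

theorem sub_ne_zero (hH : IsHolomorphicMotion Ω E b H) {l x y : ℂ} (hl : l ∈ Ω) (hx : x ∈ E)
    (hy : y ∈ E) (hxy : x ≠ y) : H l x - H l y ≠ 0 :=
  _root_.sub_ne_zero.mpr fun h => hxy (hH.vertically_injective l hl hx hy h)

theorem differentiableOn_div (hH : IsHolomorphicMotion Ω E b H) {x y u v : ℂ} (hx : x ∈ E)
    (hy : y ∈ E) (hu : u ∈ E) (hv : v ∈ E) (huv : u ≠ v) :
    DifferentiableOn ℂ (fun l => (H l x - H l y) / (H l u - H l v)) Ω :=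
  ((hH.horizontally_holomorphic x hx).sub (hH.horizontally_holomorphic y hy)).div
    ((hH.horizontally_holomorphic u hu).sub (hH.horizontally_holomorphic v hv))
    fun _ hl => hH.sub_ne_zero hl hu hv huv

theorem eventually_forall_ball_norm_div_lt (hH : IsHolomorphicMotion Ω E b H) {x w l₀ : ℂ}
    (hx : x ∈ E) (hw : w ∈ E) (hwx : w ≠ x) {R : ℝ} (hR : 0 < R) (hsub : ball l₀ R ⊆ Ω)
    (hlim : Tendsto (fun y => (H l₀ y - H l₀ x) / (H l₀ w - H l₀ x)) (𝓝[E] x) (𝓝 0))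
    {δ : ℝ} (hδ : 0 < δ) :
    ∀ᶠ y in 𝓝[E] x, ∀ l ∈ ball l₀ (R / 4), ‖(H l y - H l x) / (H l w - H l x)‖ < δ := by
  obtain ⟨ε, hε, hεf⟩ := exists_forall_norm_lt_of_omits_zero_one hδ
  filter_upwards [(tendsto_zero_iff_norm_tendsto_zero.mp hlim).eventually_lt_const hε,
    self_mem_nhdsWithin,
    eventually_nhdsWithin_of_eventually_nhds (isOpen_ne.eventually_mem hwx.symm)] with y hy hyE hyw
  rcases eq_or_ne y x with rfl | hyx
  · intro l _
    simpa using hδ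
  · refine hεf _ l₀ R hR ((hH.differentiableOn_div hyE hx hw hx hwx).mono hsub)
      (fun l hl => div_ne_zero (hH.sub_ne_zero (hsub hl) hyE hx hyx)
        (hH.sub_ne_zero (hsub hl) hw hx hwx)) (fun l hl h => ?_) hy
    rw [div_eq_one_iff_eq (hH.sub_ne_zero (hsub hl) hw hx hwx), sub_left_inj] at h
    exact hyw (hH.vertically_injective l (hsub hl) hyE hw h)

/-- The limit holds at `b`, and by the small-value estimate its validity is locally constant in `l`.
-/
theorem tendsto_div (hH : IsHolomorphicMotion Ω E b H) (hΩ : IsOpen Ω) (hΩc : IsPreconnected Ω)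
    {x w : ℂ} (hx : x ∈ E) (hw : w ∈ E) (hwx : w ≠ x) {l : ℂ} (hl : l ∈ Ω) :
    Tendsto (fun y => (H l y - H l x) / (H l w - H l x)) (𝓝[E] x) (𝓝 0) := by
  have step : ∀ {l₀ : ℂ} {R : ℝ}, 0 < R → ball l₀ R ⊆ Ω →
      Tendsto (fun y => (H l₀ y - H l₀ x) / (H l₀ w - H l₀ x)) (𝓝[E] x) (𝓝 0) →
      ∀ l ∈ ball l₀ (R / 4),
        Tendsto (fun y => (H l y - H l x) / (H l w - H l x)) (𝓝[E] x) (𝓝 0) := by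
    intro l₀ R hR hsub hlim l hl
    rw [Metric.tendsto_nhds]
    intro δ hδ
    filter_upwards [hH.eventually_forall_ball_norm_div_lt hx hw hwx hR hsub hlim hδ] with y hy
    simpa using hy l hl
  have hbase : Tendsto (fun y => (H b y - H b x) / (H b w - H b x)) (𝓝[E] x) (𝓝 0) := by
    have h1 : Tendsto (fun y => (y - x) / (w - x)) (𝓝[E] x) (𝓝 0) := by
      have : ContinuousAt (fun y => (y - x) / (w - x)) x := by fun_prop
      simpa using this.tendsto.mono_left nhdsWithin_le_nhds
    refine h1.congr' ?_
    filter_upwards [self_mem_nhdsWithin] with y hy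
    rw [hH.base y hy, hH.base x hx, hH.base w hw]
  have hiff := hΩc.eq_of_eventually_eq
    (φ := fun l => Tendsto (fun y => (H l y - H l x) / (H l w - H l x)) (𝓝[E] x) (𝓝 0))
    (fun l hl => by
      obtain ⟨R, hR, hsub⟩ := Metric.isOpen_iff.mp hΩ l hl
      filter_upwards [mem_nhdsWithin_of_mem_nhds (ball_mem_nhds l (show 0 < R / 8 by positivity))]
        with m hm
      have hm' := mem_ball.mp hm
      refine propext ⟨fun h => step (half_pos hR) ((ball_subset_ball' (by linarith)).trans hsub) h l
        (by rw [mem_ball, dist_comm]; linarith), fun h => step hR hsub h m (by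
          rw [mem_ball]; linarith)⟩) hH.base_mem hl
  exact hiff.mp hbase

theorem eventually_forall_norm_div_lt_of_isCompact (hH : IsHolomorphicMotion Ω E b H)
    (hΩ : IsOpen Ω) (hΩc : IsPreconnected Ω) {x w : ℂ} (hx : x ∈ E) (hw : w ∈ E) (hwx : w ≠ x)
    {K : Set ℂ} (hK : IsCompact K) (hKΩ : K ⊆ Ω) {δ : ℝ} (hδ : 0 < δ) :
    ∀ᶠ y in 𝓝[E] x, ∀ l ∈ K, ‖(H l y - H l x) / (H l w - H l x)‖ < δ := by
  refine hK.induction_on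
    (p := fun s => ∀ᶠ y in 𝓝[E] x, ∀ l ∈ s, ‖(H l y - H l x) / (H l w - H l x)‖ < δ)
    (by simp) (fun s t hst h => h.mono fun y hy l hl => hy l (hst hl)) ?_ ?_
  · intro s t hs ht
    filter_upwards [hs, ht] with y h1 h2 l hl using hl.elim (h1 l) (h2 l)
  · intro l hl
    obtain ⟨R, hR, hsub⟩ := Metric.isOpen_iff.mp hΩ l (hKΩ hl)
    exact ⟨ball l (R / 4), mem_nhdsWithin_of_mem_nhds (ball_mem_nhds l (by positivity)),
      hH.eventually_forall_ball_norm_div_lt hx hw hwx hR hsub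
        (hH.tendsto_div hΩ hΩc hx hw hwx (hKΩ hl)) hδ⟩

open Asymptotics in
theorem eventually_isTheta (hH : IsHolomorphicMotion Ω E b H) (hΩ : IsOpen Ω)
    (hΩc : IsPreconnected Ω) {p : ℂ} {R : ℝ} (hR : 0 < R) (hsub : ball p R \ {p} ⊆ Ω) {x w : ℂ}
    (hx : x ∈ E) (hw : w ∈ E) (hxw : x ≠ w) :
    ∀ᶠ y in 𝓝[E] x, (fun l => H l y - H l w) =Θ[𝓝[≠] p] fun l => H l x - H l w := by
  have hsph : sphere p (R / 2) ⊆ Ω := fun l hl => hsub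
    ⟨closedBall_subset_ball (half_lt_self hR) (sphere_subset_closedBall hl),
      ne_of_mem_sphere hl (half_pos hR).ne'⟩
  filter_upwards [hH.eventually_forall_norm_div_lt_of_isCompact hΩ hΩc hx hw hxw.symm
    (isCompact_sphere p (R / 2)) hsph (show (0 : ℝ) < 1 / 3 by norm_num), self_mem_nhdsWithin,
    eventually_nhdsWithin_of_eventually_nhds (isOpen_ne.eventually_mem hxw)] with y hy hyE hyw
  rcases eq_or_ne y x with rfl | hyx
  · exact isTheta_rfl
  have hbound := norm_bounds_of_norm_sub_one_le_on_sphere (half_pos hR) (half_lt_self hR)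
    ((hH.differentiableOn_div hyE hw hx hw hxw).mono hsub)
    (fun l hl => div_ne_zero (hH.sub_ne_zero (hsub hl) hyE hw hyw)
      (hH.sub_ne_zero (hsub hl) hx hw hxw))
    (fun l hl h => by
      rw [div_eq_one_iff_eq (hH.sub_ne_zero (hsub hl) hx hw hxw), sub_left_inj] at h
      exact hyx (hH.vertically_injective l (hsub hl) hyE hx h))
    (fun l hl => by
      have h1 := hH.sub_ne_zero (hsph hl) hx hw hxw
      have h2 := hH.sub_ne_zero (hsph hl) hw hx hxw.symm
      have e : (H l y - H l w) / (H l x - H l w) - 1 = -((H l y - H l x) / (H l w - H l x)) := by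
        field_simp
        ring
      rw [e, norm_neg]
      exact (hy l hl).le)
  have hev : ∀ᶠ l in 𝓝[≠] p, l ∈ closedBall p (R / 2) \ {p} :=
    inter_mem (mem_nhdsWithin_of_mem_nhds (closedBall_mem_nhds p (half_pos hR)))
      self_mem_nhdsWithin
  have hdiv : ∀ l ∈ closedBall p (R / 2) \ {p}, 1 / 2 * ‖H l x - H l w‖ ≤ ‖H l y - H l w‖ ∧
      ‖H l y - H l w‖ ≤ 2 * ‖H l x - H l w‖ := by
    intro l hl
    have hpos := norm_pos_iff.mpr (hH.sub_ne_zero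
      (hsub ⟨closedBall_subset_ball (half_lt_self hR) hl.1, hl.2⟩) hx hw hxw)
    have h := hbound l hl
    rwa [norm_div, le_div_iff₀ hpos, div_le_iff₀ hpos] at h
  refine ⟨IsBigO.of_bound 2 (hev.mono fun l hl => (hdiv l hl).2), IsBigO.of_bound 2
    (hev.mono fun l hl => ?_)⟩
  linarith [(hdiv l hl).1]

open Asymptotics in
theorem isTheta_sub (hH : IsHolomorphicMotion Ω E b H) (hΩ : IsOpen Ω) (hΩc : IsPreconnected Ω)
    (hE : IsPreconnected E) {p : ℂ} {R : ℝ} (hR : 0 < R) (hsub : ball p R \ {p} ⊆ Ω) {x y w : ℂ}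
    (hx : x ∈ E) (hy : y ∈ E) (hw : w ∈ E) (hxw : x ≠ w) (hyw : y ≠ w) :
    (fun l => H l x - H l w) =Θ[𝓝[≠] p] fun l => H l y - H l w := by
  have h := hE.eq_of_symmetric_of_eventually_eq
    -- Encoding the growth class as a set turns equivalence into equality.
    (D := fun w x => {f : ℂ → ℂ | f =Θ[𝓝[≠] p] fun l => H l x - H l w})
    (fun x y => by
      ext f
      have e : (fun l => H l y - H l x) =Θ[𝓝[≠] p] fun l => H l x - H l y :=
        IsTheta.of_norm_eventuallyEq_norm (.of_forall fun l => norm_sub_rev _ _)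
      exact ⟨fun hf => hf.trans e, fun hf => hf.trans e.symm⟩)
    (fun w hw x hx hxw => by
      filter_upwards [hH.eventually_isTheta hΩ hΩc hR hsub hx hw hxw] with y hy
      ext f
      exact ⟨fun hf => hf.trans hy, fun hf => hf.trans hy.symm⟩) hw hx hy hxw hyw
  have hmem : (fun l => H l x - H l w) ∈ {f : ℂ → ℂ | f =Θ[𝓝[≠] p] fun l => H l y - H l w} := by
    rw [← h]
    exact isTheta_rfl
  exact hmem

end IsHolomorphicMotion

/-! ### Removing the singularity -/

open Asymptotics in
theorem ExtendsHolomorphically.isBigO_one {f : ℂ → ℂ} {Ω : Set ℂ} {p : ℂ}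
    (hf : ExtendsHolomorphically f Ω (Ω ∪ {p})) (hΩ : Ω ∈ 𝓝[≠] p) :
    f =O[𝓝[≠] p] fun _ => (1 : ℝ) := by
  obtain ⟨F, hF, hFf⟩ := hf
  have hmem : Ω ∪ {p} ∈ 𝓝 p := by
    rw [union_singleton]
    exact insert_mem_nhds_iff.mpr hΩ
  refine ((hF.differentiableAt hmem).continuousAt.tendsto.isBigO_one ℝ |>.mono
    nhdsWithin_le_nhds).congr' ?_ EventuallyEq.rfl
  filter_upwards [hΩ] with l hl using hFf hl

theorem theorem2p1 (E : Set ℂ) (hE : IsConnected E)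
    (Ω : Set ℂ) (hΩ_open : IsOpen Ω) (hΩ_conn : IsConnected Ω)
    (p : ℂ) (hp : IsIsolatedBoundaryPoint Ω p)
    (b : ℂ) (H : ℂ → ℂ → ℂ) (hH : IsHolomorphicMotion Ω E b H)
    (z₀ z₁ : ℂ) (hz₀ : z₀ ∈ E) (hz₁ : z₁ ∈ E) (hne : z₀ ≠ z₁)
    (h₀ : ExtendsHolomorphically (fun l => H l z₀) Ω (Ω ∪ {p}))
    (h₁ : ExtendsHolomorphically (fun l => H l z₁) Ω (Ω ∪ {p})) :
    ExtendsHorizontallyHolomorphically H Ω (Ω ∪ {p}) E := by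
  obtain ⟨hpΩ, R, hR, hsub⟩ := hp.exists_punctured_ball_subset hΩ_open
  have hmem : Ω ∈ 𝓝[≠] p := mem_of_superset
    (inter_mem (mem_nhdsWithin_of_mem_nhds (ball_mem_nhds p hR)) self_mem_nhdsWithin) hsub
  have hO₀ := h₀.isBigO_one hmem
  have hO₁ := h₁.isBigO_one hmem
  have hO : ∀ z ∈ E, (fun l => H l z) =O[𝓝[≠] p] fun _ => (1 : ℝ) := by
    intro z hz
    rcases eq_or_ne z z₀ with rfl | hzz
    · exact hO₀
    · have h := (hH.isTheta_sub hΩ_open hΩ_conn.isPreconnected hE.isPreconnected hR hsub hz hz₁ hz₀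
        hzz hne.symm).1.trans (hO₁.sub hO₀)
      simpa using h.add hO₀
  refine ⟨fun l z => Function.update (fun l => H l z) p (limUnder (𝓝[≠] p) fun l => H l z) l,
    fun z hz => ?_, fun l hl z _ => Function.update_of_ne (ne_of_mem_of_not_mem hl hpΩ) _ _⟩
  rw [union_singleton]
  refine Complex.differentiableOn_update_limUnder_insert_of_isLittleO hmem
    (hH.horizontally_holomorphic z hz) (IsBoundedUnder.isLittleO_sub_self_inv ?_)
  -- `H p z` is an arbitrary value, as `p ∉ Ω`; subtracting it only matches the form of the
  -- removability criterion.
  have h2 := (hO z hz).sub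
    (Asymptotics.isBigO_const_const (H p z) (one_ne_zero (α := ℝ)) (𝓝[≠] p))
  exact (Asymptotics.isBigO_one_iff ℝ).mp h2
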